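/- Identify an angle $\theta\in\mathbb R/2\pi\mathbb Z$ with the point $e^{i\theta}\in\mathbb S^1$; derivatives $D$, $D^2$ of circle maps are taken with respect to the angle. Let $\mathcal M\cong \mathrm{PSL}(2,\mathbb R)$ be the topological group (with the topology of uniform convergence) of all M\"obius transformations of the circle $z\mapsto e^{i\kappa}\,\frac{z-\sigma}{1-\bar\sigma z}$ with $\kappa\in\mathbb R$, $\sigma\in\mathbb C$, $|\sigma|<1$, and let $\mathrm{SO}(2,\mathbb R)\subset\mathcal M$ be the subgroup of rotations $z\mapsto e^{i\kappa}z$. For an orientation preserving $C^2$ diffeomorphism $f$ of the circle and $\theta\in\mathbb S^1$, the projective derivative $P_{f,\theta}$ is the unique element $P$ of $\mathcal M$ with $P(\theta)=f(\theta)$, $DP(\theta)=Df(\theta)$ and $D^2P(\theta)=D^2f(\theta)$. **Theorem A.** Let $\Gamma$ be a group of orientation preserving $C^2$ diffeomorphisms of the circle. The following are equivalent: 1. the projective cocycle of $\Gamma$ is $\mathrm{SO}(2,\mathbb R)$-reducible, that is, there is a continuous map $B:\mathbb S^1\to\mathcal M$ such that $B(f(\theta))\circ P_{f,\theta}\circ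 B(\theta)^{-1}\in \mathrm{SO}(2,\mathbb R)$ for all $f\in\Gamma$ and all $\theta\in\mathbb S^1$; 2. the action of $\Gamma$ is $C^2$-conjugate to an action by rotations, that is, there is an orientation preserving $C^2$ diffeomorphism $\varphi$ of the circle such that $\varphi\circ f\circ\varphi^{-1}$ is a rotation for every $f\in\Gamma$. -/

import Mathlib

open scoped ComplexConjugate

noncomputable section

/-! ### Orientation preserving `C²` diffeomorphisms of the circle -/

/-- `f` has a lift to the line (in the angle coordinate `x ↦ e^{ix}`) of class `C²` with positive
derivative; that is, `f` is an orientation preserving `C²` map without critical points. -/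
def HasC2Lift (f : Circle → Circle) : Prop :=
  ∃ F : ℝ → ℝ, ContDiff ℝ 2 F ∧ (∀ x, 0 < deriv F x) ∧
    ∀ x, Circle.exp (F x) = f (Circle.exp x)

theorem HasC2Lift.comp {f g : Circle → Circle} (hf : HasC2Lift f) (hg : HasC2Lift g) :
    HasC2Lift (f ∘ g) := by
  obtain ⟨F, hF, hF', hFf⟩ := hf
  obtain ⟨G, hG, hG', hGg⟩ := hg
  refine ⟨F ∘ G, hF.comp hG, fun x => ?_, fun x => ?_⟩
  · rw [deriv_comp x (hF.differentiable (by norm_num) _) (hG.differentiable (by norm_num) _)]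
    exact mul_pos (hF' _) (hG' _)
  · simp [hFf, hGg]

/-- The group `Diff²₊(S¹)` of orientation preserving `C²` diffeomorphisms of the circle. -/
def CircleDiff2 : Subgroup (Circle ≃ₜ Circle) where
  carrier := {f | HasC2Lift f ∧ HasC2Lift f.symm}
  mul_mem' := fun {_ _} hf hg => ⟨hf.1.comp hg.1, hg.2.comp hf.2⟩
  one_mem' := by
    have h : HasC2Lift (fun z => z) :=
      ⟨fun x => x, contDiff_id, fun x => by simp, fun x => rfl⟩
    exact ⟨h, h⟩
  inv_mem' := fun {_} hf => ⟨hf.2, hf.1⟩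

/-- The action of `Diff²₊(S¹)`, hence of each of its subgroups, on the circle. -/
instance : MulAction CircleDiff2 Circle where
  smul f z := f.1 z
  one_smul _ := rfl
  mul_smul _ _ _ := rfl

/-! ### First and second derivatives in the angle coordinate -/

/-- The map `f` read in the angle coordinates centred at `z` and at `f z`:
`t ↦ arg (f (z e^{it}) / f z)`. -/
def angularChart (f : Circle → Circle) (z : Circle) (t : ℝ) : ℝ :=
  Complex.arg ((f (z * Circle.exp t) / f z : Circle) : ℂ)

/-- The derivative `Df` at the point `z`, with respect to the angle. -/
def angularDeriv (f : Circle → Circle) (z : Circle) : ℝ :=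
  deriv (angularChart f z) 0

/-- The second derivative `D²f` at the point `z`, with respect to the angle. -/
def angularDeriv2 (f : Circle → Circle) (z : Circle) : ℝ :=
  deriv (deriv (angularChart f z)) 0

theorem angularChart_eventuallyEq {f : Circle → Circle} {z : Circle} {F : ℝ → ℝ} {x : ℝ}
    (hx : Circle.exp x = z) (hF : Continuous F)
    (h : ∀ y, Circle.exp (F y) = f (Circle.exp y)) :
    angularChart f z =ᶠ[nhds 0] fun t => F (x + t) - F x := by
  have hc : Continuous fun t => F (x + t) - F x := by fun_prop
  have h0 : Filter.Tendsto (fun t => F (x + t) - F x) (nhds 0) (nhds 0) := by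
    have := hc.tendsto 0
    simpa using this
  filter_upwards [h0.eventually (Ioo_mem_nhds (neg_lt_zero.2 Real.pi_pos) Real.pi_pos)]
    with t ht
  have : (f (z * Circle.exp t) / f z : Circle) = Circle.exp (F (x + t) - F x) := by
    rw [Circle.exp_sub, h, h, Circle.exp_add, hx]
  rw [angularChart, this, Circle.arg_exp ht.1 ht.2.le]

theorem angularDeriv_eq {f : Circle → Circle} {z : Circle} {F : ℝ → ℝ} {x : ℝ}
    (hx : Circle.exp x = z) (hF : Continuous F)
    (h : ∀ y, Circle.exp (F y) = f (Circle.exp y)) :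
    angularDeriv f z = deriv F x := by
  rw [angularDeriv, (angularChart_eventuallyEq hx hF h).deriv_eq, deriv_sub_const,
    deriv_comp_const_add, add_zero]

theorem angularDeriv2_eq {f : Circle → Circle} {z : Circle} {F : ℝ → ℝ} {x : ℝ}
    (hx : Circle.exp x = z) (hF : Continuous F)
    (h : ∀ y, Circle.exp (F y) = f (Circle.exp y)) :
    angularDeriv2 f z = deriv (deriv F) x := by
  rw [angularDeriv2, (angularChart_eventuallyEq hx hF h).deriv.deriv_eq]
  have : (deriv fun t => F (x + t) - F x) = fun t => deriv F (x + t) := by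
    funext t
    rw [deriv_sub_const, deriv_comp_const_add]
  rw [this, deriv_comp_const_add, add_zero]

theorem HasC2Lift.angularDeriv_pos {f : Circle → Circle} (hf : HasC2Lift f) (z : Circle) :
    0 < angularDeriv f z := by
  obtain ⟨F, hF, hF', hFf⟩ := hf
  rw [angularDeriv_eq (Circle.exp_arg z) hF.continuous hFf]
  exact hF' _

/-! ### The Möbius group of the circle -/

/-- `f` is the boundary map of the Möbius transformation of the unit disc
`z ↦ e^{iκ} (z - σ) / (1 - conj σ z)`, where `c = e^{iκ}` and `|σ| < 1`. -/
def IsMobiusWith (f : Circle → Circle) (c : Circle) (σ : ℂ) : Prop :=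
  ‖σ‖ < 1 ∧ ∀ z : Circle, (f z : ℂ) = c * ((z - σ) / (1 - conj σ * z))

theorem one_sub_ne_zero_of_norm_lt {w : ℂ} (hw : ‖w‖ < 1) : 1 - w ≠ 0 := by
  intro h
  rw [sub_eq_zero] at h
  rw [← h] at hw
  simp at hw

theorem one_sub_conj_mul_ne_zero {σ : ℂ} (hσ : ‖σ‖ < 1) (z : Circle) :
    1 - conj σ * (z : ℂ) ≠ 0 :=
  one_sub_ne_zero_of_norm_lt (by rwa [norm_mul, Complex.norm_conj, Circle.norm_coe, mul_one])

theorem Circle.coe_mul_conj (c : Circle) : (c : ℂ) * conj (c : ℂ) = 1 := by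
  rw [Complex.mul_conj, Circle.normSq_coe, Complex.ofReal_one]

theorem norm_div_lt_one {a b : ℂ} (h : Complex.normSq b < Complex.normSq a) : ‖b / a‖ < 1 := by
  rw [Complex.normSq_eq_norm_sq, Complex.normSq_eq_norm_sq] at h
  have h1 : ‖b‖ < ‖a‖ := lt_of_pow_lt_pow_left₀ 2 (norm_nonneg _) h
  rw [norm_div, div_lt_one (lt_of_le_of_lt (norm_nonneg _) h1)]
  exact h1

theorem norm_neg_circle_mul_lt {c : Circle} {σ : ℂ} (hσ : ‖σ‖ < 1) : ‖-((c : ℂ) * σ)‖ < 1 := by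
  rwa [norm_neg, norm_mul, Circle.norm_coe, one_mul]

theorem IsMobiusWith.comp {f g : Circle → Circle} {c d : Circle} {σ τ : ℂ}
    (hf : IsMobiusWith f c σ) (hg : IsMobiusWith g d τ) :
    ∃ e ρ, IsMobiusWith (f ∘ g) e ρ := by
  obtain ⟨hσ, hf⟩ := hf
  obtain ⟨hτ, hg⟩ := hg
  have hd := Circle.coe_mul_conj d
  have hd0 : (d : ℂ) ≠ 0 := Circle.coe_ne_zero d
  have hστ : ‖conj σ * d * τ‖ < 1 := by
    rw [norm_mul, norm_mul, Complex.norm_conj, Circle.norm_coe, mul_one]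
    exact mul_lt_one_of_nonneg_of_lt_one_left (norm_nonneg σ) hσ hτ.le
  have hq0 : 1 + conj σ * d * τ ≠ 0 := by
    have := one_sub_ne_zero_of_norm_lt (w := -(conj σ * d * τ)) (by rwa [norm_neg])
    simpa using this
  have haq : (d : ℂ) + σ * conj τ = d * conj (1 + conj σ * d * τ) := by
    simp only [map_add, map_mul, map_one, Complex.conj_conj]
    linear_combination (-σ * conj τ) * hd
  have ha0 : (d : ℂ) + σ * conj τ ≠ 0 := by
    rw [haq]
    exact mul_ne_zero hd0 ((map_ne_zero _).2 hq0)
  have hnorm : ‖((d : ℂ) + σ * conj τ) / (1 + conj σ * d * τ)‖ = 1 := by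
    rw [haq, norm_div, norm_mul, Circle.norm_coe, one_mul, Complex.norm_conj,
      div_self (norm_ne_zero_iff.2 hq0)]
  obtain ⟨e, he⟩ : ∃ e : Circle, (e : ℂ) = ((d : ℂ) + σ * conj τ) / (1 + conj σ * d * τ) :=
    ⟨⟨_, by simpa [Submonoid.unitSphere] using hnorm⟩, rfl⟩
  refine ⟨c * e, (d * τ + σ) / (d + σ * conj τ), ?_, ?_⟩
  · apply norm_div_lt_one
    have key : (((Complex.normSq (d + σ * conj τ) - Complex.normSq (d * τ + σ) : ℝ)) : ℂ) =
        (((1 - Complex.normSq σ) * (1 - Complex.normSq τ) : ℝ) : ℂ) := by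
      push_cast
      simp only [← Complex.mul_conj, map_add, map_mul, Complex.conj_conj]
      linear_combination (1 - τ * conj τ) * hd
    have key' := Complex.ofReal_injective key
    have h1 : Complex.normSq σ < 1 := by
      rw [Complex.normSq_eq_norm_sq]; nlinarith [norm_nonneg σ]
    have h2 : Complex.normSq τ < 1 := by
      rw [Complex.normSq_eq_norm_sq]; nlinarith [norm_nonneg τ]
    nlinarith [mul_pos (sub_pos.2 h1) (sub_pos.2 h2)]
  · intro z
    have hz1 := one_sub_conj_mul_ne_zero hτ z
    have hz2 := one_sub_conj_mul_ne_zero hσ (g z)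
    rw [Function.comp_apply, hf, hg]
    rw [hg] at hz2
    have hρ : conj (((d : ℂ) * τ + σ) / (d + σ * conj τ)) =
        (conj τ + conj σ * d) / (1 + conj σ * d * τ) := by
      rw [map_div₀, div_eq_div_iff ((map_ne_zero _).2 ha0) hq0]
      simp only [map_add, map_mul, Complex.conj_conj]
      linear_combination (conj τ * conj σ * τ - conj σ) * hd
    have hden : (1 + conj σ * d * τ) - (conj τ + conj σ * d) * z =
        (1 - conj τ * z) * (1 - conj σ * (d * ((z - τ) / (1 - conj τ * z)))) := by
      field_simp
      ring
    have hden0 : (1 + conj σ * d * τ) - (conj τ + conj σ * d) * z ≠ 0 := by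
      rw [hden]
      exact mul_ne_zero hz1 hz2
    have e1 : 1 - (conj τ + conj σ * d) / (1 + conj σ * d * τ) * (z : ℂ) =
        ((1 + conj σ * d * τ) - (conj τ + conj σ * d) * z) / (1 + conj σ * d * τ) := by
      field_simp
    have e2 : (z : ℂ) - (d * τ + σ) / (d + σ * conj τ) =
        (z * (d + σ * conj τ) - (d * τ + σ)) / (d + σ * conj τ) := by
      field_simp
    have e3 : (d : ℂ) * ((z - τ) / (1 - conj τ * z)) - σ =
        (z * (d + σ * conj τ) - (d * τ + σ)) / (1 - conj τ * z) := by
      rw [mul_div_assoc', div_sub' hz1]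
      congr 1
      ring
    have e4 : (1 - conj σ * (d * ((z - τ) / (1 - conj τ * z)))) =
        ((1 + conj σ * d * τ) - (conj τ + conj σ * d) * z) / (1 - conj τ * z) := by
      rw [hden, mul_div_cancel_left₀ _ hz1]
    rw [hρ, e1, e2, e3, e4, Circle.coe_mul, he, div_div_div_cancel_right₀ hz1]
    generalize (1 + conj σ * d * τ) - (conj τ + conj σ * d) * z = q at *
    generalize 1 + conj σ * d * τ = p at *
    field_simp

theorem IsMobiusWith.symm {f : Circle ≃ₜ Circle} {c : Circle} {σ : ℂ}
    (hf : IsMobiusWith f c σ) : IsMobiusWith f.symm c⁻¹ (-(c * σ)) := by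
  obtain ⟨hσ, hf⟩ := hf
  refine ⟨norm_neg_circle_mul_lt hσ, fun w => ?_⟩
  have h := hf (f.symm w)
  rw [f.apply_symm_apply] at h
  have h1 := one_sub_conj_mul_ne_zero hσ (f.symm w)
  have h2 : 1 - conj (-(c * σ)) * (w : ℂ) ≠ 0 :=
    one_sub_conj_mul_ne_zero (norm_neg_circle_mul_lt hσ) w
  have hc := Circle.coe_mul_conj c
  have hc0 : (c : ℂ) ≠ 0 := Circle.coe_ne_zero c
  rw [← mul_div_assoc, eq_div_iff h1] at h
  rw [← mul_div_assoc, eq_div_iff h2, Circle.coe_inv, inv_mul_eq_div, eq_div_iff hc0]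
  simp only [map_neg, map_mul]
  linear_combination -h + (w * conj σ * (f.symm w : ℂ)) * hc

/-- The group `𝓜 ≅ PSL(2,ℝ)` of Möbius transformations of the circle. -/
def Mobius : Subgroup (Circle ≃ₜ Circle) where
  carrier := {f | ∃ c σ, IsMobiusWith f c σ}
  mul_mem' := by
    rintro f g ⟨c, σ, hf⟩ ⟨d, τ, hg⟩
    exact hf.comp hg
  one_mem' := ⟨1, 0, by simp, fun z => by simp⟩
  inv_mem' := by
    rintro f ⟨c, σ, hf⟩
    exact ⟨_, _, hf.symm⟩

/-- The topology of uniform convergence (the compact-open topology) on the Möbius group. -/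
instance : TopologicalSpace Mobius :=
  TopologicalSpace.induced (fun P : Mobius => (⟨P.1, P.1.continuous⟩ : C(Circle, Circle)))
    inferInstance

/-- The subgroup `SO(2,ℝ)` of rotations in the Möbius group. -/
def rotationSubgroup : Subgroup Mobius where
  carrier := {P | ∃ c : Circle, ∀ z, P.1 z = c * z}
  mul_mem' := by
    rintro P Q ⟨c, hP⟩ ⟨d, hQ⟩
    refine ⟨c * d, fun z => ?_⟩
    change P.1 (Q.1 z) = _
    rw [hP, hQ, mul_assoc]
  one_mem' := ⟨1, fun z => (one_mul z).symm⟩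
  inv_mem' := by
    rintro P ⟨c, hP⟩
    refine ⟨c⁻¹, fun z => ?_⟩
    change P.1.symm z = _
    rw [Homeomorph.symm_apply_eq, hP, mul_inv_cancel_left]

/-! ### The projective derivative -/

/-- `P` coincides with `f` up to order two at `z`. -/
def SameTwoJet (P f : Circle → Circle) (z : Circle) : Prop :=
  P z = f z ∧ angularDeriv P z = angularDeriv f z ∧ angularDeriv2 P z = angularDeriv2 f z

/-- A lift of a Möbius transformation to the line. -/
def mobiusLift (k : ℝ) (σ : ℂ) (x : ℝ) : ℝ :=
  k + x + 2 * (Complex.log (1 - σ * Complex.exp (-(x * Complex.I)))).im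

theorem norm_mul_exp_lt {σ : ℂ} (hσ : ‖σ‖ < 1) (x : ℝ) :
    ‖σ * Complex.exp (-(x * Complex.I))‖ < 1 := by
  have : -((x : ℂ) * Complex.I) = ((-x : ℝ) : ℂ) * Complex.I := by push_cast; ring
  rwa [norm_mul, this, Complex.norm_exp_ofReal_mul_I, mul_one]

theorem one_sub_mem_slitPlane {w : ℂ} (hw : ‖w‖ < 1) : 1 - w ∈ Complex.slitPlane := by
  left
  have := (Complex.re_le_norm w).trans_lt hw
  simpa using this

theorem exp_mobiusLift {f : Circle → Circle} {k : ℝ} {σ : ℂ}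
    (hf : IsMobiusWith f (Circle.exp k) σ) (x : ℝ) :
    Circle.exp (mobiusLift k σ x) = f (Circle.exp x) := by
  obtain ⟨hσ, hf⟩ := hf
  apply Subtype.ext
  have hz1 := one_sub_conj_mul_ne_zero hσ (Circle.exp x)
  rw [hf]
  set u : ℂ := 1 - σ * Complex.exp (-(x * Complex.I)) with hu
  have hu0 : u ≠ 0 := one_sub_ne_zero_of_norm_lt (norm_mul_exp_lt hσ x)
  have hcu : conj u = 1 - conj σ * (Circle.exp x : ℂ) := by
    rw [hu, map_sub, map_one, map_mul, ← Complex.exp_conj, Circle.coe_exp]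
    simp
  have hexp : Complex.exp ((2 * (Complex.log u).im : ℝ) * Complex.I) = u / conj u := by
    have h1 : ((2 * (Complex.log u).im : ℝ) : ℂ) * Complex.I =
        Complex.log u - conj (Complex.log u) := by
      rw [Complex.sub_conj]
    rw [h1, Complex.exp_sub, Complex.exp_conj, Complex.exp_log hu0]
  have hxu : (Circle.exp x : ℂ) - σ = Circle.exp x * u := by
    have : (Circle.exp x : ℂ) * Complex.exp (-(x * Complex.I)) = 1 := by
      rw [Circle.coe_exp, ← Complex.exp_add, add_neg_cancel, Complex.exp_zero]
    rw [hu]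
    linear_combination σ * this
  rw [hxu, ← hcu, mul_div_assoc, ← hexp, mobiusLift, Circle.exp_add, Circle.exp_add,
    Circle.coe_mul, Circle.coe_mul, Circle.coe_exp (2 * _), mul_assoc]

theorem hasDerivAt_mul_exp (σ : ℂ) (x : ℝ) :
    HasDerivAt (fun y : ℝ => 1 - σ * Complex.exp (-(y * Complex.I)))
      (Complex.I * (σ * Complex.exp (-(x * Complex.I)))) x := by
  have h1 : HasDerivAt (fun y : ℝ => -((y : ℂ) * Complex.I)) (-(1 * Complex.I)) x :=
    ((Complex.ofRealCLM.hasDerivAt (x := x)).mul_const Complex.I).neg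
  have h2 := ((h1.cexp.const_mul σ).const_sub 1)
  refine h2.congr_deriv ?_
  ring

theorem hasDerivAt_mobiusLift {σ : ℂ} (hσ : ‖σ‖ < 1) (k x : ℝ) :
    HasDerivAt (mobiusLift k σ)
      (2 * (1 - σ * Complex.exp (-(x * Complex.I)))⁻¹.re - 1) x := by
  have hs := norm_mul_exp_lt hσ x
  have h1 := (hasDerivAt_mul_exp σ x).clog_real (one_sub_mem_slitPlane hs)
  have h2 := Complex.imCLM.hasFDerivAt.comp_hasDerivAt x h1
  have h3 := ((hasDerivAt_id x).const_add k).add (h2.const_mul 2)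
  refine h3.congr_deriv ?_
  set t := σ * Complex.exp (-(x * Complex.I))
  have ht : 1 - t ≠ 0 := one_sub_ne_zero_of_norm_lt hs
  have : Complex.I * t / (1 - t) = Complex.I * ((1 - t)⁻¹ - 1) := by
    field_simp
    ring
  rw [this]
  simp
  ring

theorem deriv_deriv_mobiusLift {σ : ℂ} (hσ : ‖σ‖ < 1) (k x : ℝ) :
    deriv (deriv (mobiusLift k σ)) x =
      2 * (2 * (1 - σ * Complex.exp (-(x * Complex.I)))⁻¹.re - 1) *
        (1 - σ * Complex.exp (-(x * Complex.I)))⁻¹.im := by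
  have h0 : deriv (mobiusLift k σ) = fun y : ℝ =>
      2 * (1 - σ * Complex.exp (-(y * Complex.I)))⁻¹.re - 1 :=
    funext fun y => (hasDerivAt_mobiusLift hσ k y).deriv
  have hs := norm_mul_exp_lt hσ x
  have ht := one_sub_ne_zero_of_norm_lt hs
  have h1 := (hasDerivAt_mul_exp σ x).fun_inv ht
  have h2 := Complex.reCLM.hasFDerivAt.comp_hasDerivAt x h1
  have h3 := (h2.const_mul 2).sub_const 1
  rw [h0]
  refine h3.deriv.trans ?_
  set t := σ * Complex.exp (-(x * Complex.I))
  have : -(Complex.I * t) / (1 - t) ^ 2 = Complex.I * ((1 - t)⁻¹ - (1 - t)⁻¹ * (1 - t)⁻¹) := by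
    field_simp
    ring
  rw [this]
  simp
  ring

/-- The first and second derivatives of a Möbius transformation at `z`, in terms of the
real and imaginary parts of `(1 - σ / z)⁻¹`. -/
theorem IsMobiusWith.angularDeriv_eq {f : Circle → Circle} {c : Circle} {σ : ℂ}
    (hf : IsMobiusWith f c σ) (z : Circle) :
    angularDeriv f z = 2 * (1 - σ * conj (z : ℂ))⁻¹.re - 1 ∧
    angularDeriv2 f z =
      2 * (2 * (1 - σ * conj (z : ℂ))⁻¹.re - 1) * (1 - σ * conj (z : ℂ))⁻¹.im := by
  obtain ⟨k, rfl⟩ := Circle.exp_surjective c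
  obtain ⟨x, rfl⟩ := Circle.exp_surjective z
  have hcont : Continuous (mobiusLift k σ) :=
    continuous_iff_continuousAt.2 fun y => (hasDerivAt_mobiusLift hf.1 k y).continuousAt
  have hx : conj (Circle.exp x : ℂ) = Complex.exp (-(x * Complex.I)) := by
    rw [Circle.coe_exp, ← Complex.exp_conj]
    simp
  rw [_root_.angularDeriv_eq rfl hcont (exp_mobiusLift hf),
    angularDeriv2_eq rfl hcont (exp_mobiusLift hf), hx]
  exact ⟨(hasDerivAt_mobiusLift hf.1 k x).deriv, deriv_deriv_mobiusLift hf.1 k x⟩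

/-- The map of the circle with parameters `c`, `σ` exists as an element of the Möbius group. -/
theorem exists_mobiusWith (c : Circle) {σ : ℂ} (hσ : ‖σ‖ < 1) :
    ∃ P : Mobius, IsMobiusWith P.1 c σ := by
  have main : ∀ (c : Circle) {σ : ℂ}, ‖σ‖ < 1 → ∃ f : Circle → Circle, Continuous f ∧
      IsMobiusWith f c σ := by
    intro c σ hσ
    have hn : ∀ z : Circle, ‖(c : ℂ) * ((z - σ) / (1 - conj σ * z))‖ = 1 := by
      intro z
      have h1 := one_sub_conj_mul_ne_zero hσ z
      have h2 : (z : ℂ) - σ = z * conj (1 - conj σ * (z : ℂ)) := by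
        simp only [map_sub, map_mul, map_one, Complex.conj_conj]
        linear_combination σ * Circle.coe_mul_conj z
      rw [h2, norm_mul, norm_div, norm_mul, Complex.norm_conj, Circle.norm_coe, Circle.norm_coe,
        one_mul, one_mul, div_self (norm_ne_zero_iff.2 h1)]
    refine ⟨fun z => ⟨_, by simpa [Submonoid.unitSphere] using hn z⟩, ?_, hσ, fun z => rfl⟩
    refine Continuous.subtype_mk ?_ _
    refine continuous_const.mul (Continuous.div (by fun_prop) (by fun_prop) ?_)
    exact fun z => one_sub_conj_mul_ne_zero hσ z
  obtain ⟨f, hfc, hf⟩ := main c hσ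
  obtain ⟨g, hgc, hg⟩ := main c⁻¹ (σ := -(c * σ)) (norm_neg_circle_mul_lt hσ)
  have inv : ∀ (c d : Circle) (σ τ : ℂ) (f g : Circle → Circle), d = c⁻¹ → τ = -(c * σ) →
      IsMobiusWith f c σ → IsMobiusWith g d τ → Function.LeftInverse g f := by
    rintro c _ σ _ f g rfl rfl hf hg z
    apply Subtype.ext
    have h1 := one_sub_conj_mul_ne_zero hf.1 z
    have h2 := one_sub_conj_mul_ne_zero hg.1 (f z)
    have hc := Circle.coe_mul_conj c
    have hc0 : (c : ℂ) ≠ 0 := Circle.coe_ne_zero c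
    have hz := hf.2 z
    rw [hg.2, ← mul_div_assoc, div_eq_iff h2, Circle.coe_inv, inv_mul_eq_div, div_eq_iff hc0]
    rw [← mul_div_assoc, eq_div_iff h1] at hz
    simp only [map_neg, map_mul]
    linear_combination hz - ((z : ℂ) * conj σ * (f z : ℂ)) * hc
  refine ⟨⟨⟨⟨f, g, inv _ _ _ _ f g rfl rfl hf hg, ?_⟩, hfc, hgc⟩, c, σ, hf⟩, hf⟩
  refine inv _ _ _ _ g f (inv_inv c).symm ?_ hg hf
  rw [Circle.coe_inv]
  field_simp [Circle.coe_ne_zero c]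

/-- Existence and uniqueness of the Möbius transformation with the 2-jet of `f` at `z`. -/
theorem existsUnique_sameTwoJet (f : CircleDiff2) (z : Circle) :
    ∃! P : Mobius, SameTwoJet P.1 f.1 z := by
  have hD : 0 < angularDeriv f.1 z := f.2.1.angularDeriv_pos z
  set D := angularDeriv f.1 z with hDdef
  set E := angularDeriv2 f.1 z with hEdef
  have hz := Circle.coe_mul_conj z
  have hz0 : (z : ℂ) ≠ 0 := Circle.coe_ne_zero z
  refine existsUnique_of_exists_of_unique ?_ ?_
  · set w : ℂ := ⟨(1 + D) / 2, E / (2 * D)⟩ with hw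
    have hw0 : w ≠ 0 := by
      intro h
      have := congrArg Complex.re h
      simp only [hw, Complex.zero_re] at this
      linarith
    have hτ : ‖(w - 1) / w‖ < 1 := by
      apply norm_div_lt_one
      simp only [Complex.normSq_apply, Complex.sub_re, Complex.sub_im, Complex.one_re,
        Complex.one_im, hw]
      nlinarith
    have hσ : ‖(w - 1) / w * z‖ < 1 := by
      rw [norm_mul, Circle.norm_coe, mul_one]
      exact hτ
    obtain ⟨Q, hQ⟩ := exists_mobiusWith 1 hσ
    obtain ⟨P, hP⟩ := exists_mobiusWith (f.1 z / Q.1 z) hσ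
    refine ⟨P, ?_, ?_⟩
    · apply Subtype.ext
      have h1 := hP.2 z
      have h2 := hQ.2 z
      rw [Circle.coe_one, one_mul] at h2
      rw [h1, ← h2, Circle.coe_div, div_mul_cancel₀ _ (Circle.coe_ne_zero _)]
    · have hinv : (1 - (w - 1) / w * z * conj (z : ℂ))⁻¹ = w := by
        rw [mul_assoc, hz, mul_one]
        field_simp
        simp
      have h := hP.angularDeriv_eq z
      rw [hinv] at h
      refine ⟨h.1.trans ?_, h.2.trans ?_⟩
      · simp only [hw]
        ring
      · simp only [hw]
        field_simp
        ring
  · rintro P Q ⟨hP0, hP1, hP2⟩ ⟨hQ0, hQ1, hQ2⟩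
    obtain ⟨c, σ, hP⟩ := P.2
    obtain ⟨d, τ, hQ⟩ := Q.2
    have h := hP.angularDeriv_eq z
    have h' := hQ.angularDeriv_eq z
    rw [hP1, hP2] at h
    rw [hQ1, hQ2] at h'
    have hre : (1 - σ * conj (z : ℂ))⁻¹.re = (1 - τ * conj (z : ℂ))⁻¹.re := by
      linarith [h.1, h'.1]
    have him : (1 - σ * conj (z : ℂ))⁻¹.im = (1 - τ * conj (z : ℂ))⁻¹.im := by
      have e1 := h.2
      have e2 := h'.2
      rw [← h.1] at e1
      rw [← h'.1] at e2
      have : 2 * D * (1 - σ * conj (z : ℂ))⁻¹.im = 2 * D * (1 - τ * conj (z : ℂ))⁻¹.im :=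
        e1.symm.trans e2
      exact mul_left_cancel₀ (by positivity) this
    have hst : σ * conj (z : ℂ) = τ * conj (z : ℂ) := by
      have := inv_injective (Complex.ext hre him)
      linear_combination -this
    have hστ : σ = τ := mul_right_cancel₀ ((map_ne_zero _).2 hz0) hst
    subst hστ
    have hcd : (c : ℂ) = d := by
      have e : (P.1 z : ℂ) = Q.1 z := by rw [hP0, hQ0]
      rw [hP.2 z, hQ.2 z] at e
      have hne : ((z : ℂ) - σ) / (1 - conj σ * z) ≠ 0 := by
        intro h0
        have := hP.2 z
        rw [h0, mul_zero] at this
        exact Circle.coe_ne_zero _ this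
      exact mul_right_cancel₀ hne e
    apply Subtype.ext
    apply Homeomorph.ext
    intro x
    apply Subtype.ext
    rw [hP.2 x, hQ.2 x, hcd]

/-- The projective derivative of `f` at `z`: the unique Möbius transformation that coincides
with `f` up to order two at `z`. -/
def projectiveDerivative (f : CircleDiff2) (z : Circle) : Mobius :=
  (existsUnique_sameTwoJet f z).choose

/-! ### Reducibility and conjugacy -/

/-- A `G`-valued cocycle `A` above an action of `Γ` on `X` is `H`-reducible if it is cohomologous,
via a continuous map `B : X → G`, to a cocycle with values in the subgroup `H`. -/
def IsReducible {Γ X G : Type*} [Group Γ] [MulAction Γ X] [TopologicalSpace X]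
    [Group G] [TopologicalSpace G] (A : Γ → X → G) (H : Subgroup G) : Prop :=
  ∃ B : C(X, G), ∀ (f : Γ) (x : X), B (f • x) * A f x * (B x)⁻¹ ∈ H

/-- The action of the group `Γ` is conjugate, via a `C²` diffeomorphism of the circle, to an
action by rotations. -/
def IsC2ConjugateToRotations (Γ : Subgroup CircleDiff2) : Prop :=
  ∃ φ : CircleDiff2, ∀ f ∈ Γ, ∃ c : Circle, ∀ z : Circle, (φ * f * φ⁻¹) • z = c * z

end

noncomputable section

/-! ### Calculus of 2-jets in the angle coordinate -/

/-! The 2-jet of a composite depends only on the 2-jets of its factors, so uniqueness gives the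
projective derivative a chain rule (`projectiveDerivative_mul`). If `φ` conjugates `Γ` to rotations,
`B = projectiveDerivative φ` reduces the cocycle: it turns it into the projective derivative of `φ *
f * φ⁻¹`, and a rotation is its own projective derivative.

Conversely, let `B` reduce the cocycle and take the 2-jet of `B z` at `z`. Composing with a rotation
on the left changes neither derivative, so `a = D(B z)(z)` and `b = D²(B z)(z) / D(B z)(z)` satisfy
`a(f) Df = a` and `b(f) Df + D²f / Df = b` (`exists_invariant_of_isReducible`). A normalised
primitive `Φ` of `a` turns the lifts of `Γ` into translations. It is a `C²` conjugacy as soon as `a`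
is `C¹`, but `a` is a priori only continuous.

If `Γ` is finite, the sum of the `Df` over `Γ` is a `C¹` invariant density. If `Γ` is infinite, let
`β` be a primitive of `b` and `u = β - log a`. The two invariances make `u ∘ F - u` constant for
each lift `F`. In the coordinate `Φ` these lifts are translations by a dense group, so `u` is an
affine function of `Φ`. Hence `log a`, which is `β` minus that function, is `C¹`
(`contDiff_density_of_infinite`). -/

theorem isQuotientMap_circleExp : Topology.IsQuotientMap Circle.exp :=
  isLocalHomeomorph_circleExp.isOpenMap.isQuotientMap Circle.exp.continuous Circle.exp_surjective

/-- The function `f` has the lift `F`, of class `C²` and with positive derivative. -/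
structure IsC2LiftOf (F : ℝ → ℝ) (f : Circle → Circle) : Prop where
  contDiff : ContDiff ℝ 2 F
  deriv_pos : ∀ x, 0 < deriv F x
  exp_eq : ∀ x, Circle.exp (F x) = f (Circle.exp x)

theorem HasC2Lift.exists_lift {f : Circle → Circle} (hf : HasC2Lift f) :
    ∃ F, IsC2LiftOf F f := by
  obtain ⟨F, h1, h2, h3⟩ := hf
  exact ⟨F, h1, h2, h3⟩

namespace IsC2LiftOf

variable {F : ℝ → ℝ} {f : Circle → Circle}

theorem hasDerivAt (hF : IsC2LiftOf F f) (x : ℝ) : HasDerivAt F (deriv F x) x :=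
  (hF.contDiff.differentiable (by norm_num) x).hasDerivAt

theorem contDiff_deriv (hF : IsC2LiftOf F f) : ContDiff ℝ 1 (deriv F) := by
  have h : ContDiff ℝ (1 + 1) F := by
    have := hF.contDiff
    norm_num
    exact this
  exact (contDiff_succ_iff_deriv.1 h).2.2

theorem hasDerivAt_deriv (hF : IsC2LiftOf F f) (x : ℝ) :
    HasDerivAt (deriv F) (deriv (deriv F) x) x :=
  (hF.contDiff_deriv.differentiable (by norm_num) x).hasDerivAt

theorem angularDeriv_exp (hF : IsC2LiftOf F f) (x : ℝ) :
    angularDeriv f (Circle.exp x) = deriv F x :=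
  angularDeriv_eq rfl hF.contDiff.continuous hF.exp_eq

theorem angularDeriv2_exp (hF : IsC2LiftOf F f) (x : ℝ) :
    angularDeriv2 f (Circle.exp x) = deriv (deriv F) x :=
  angularDeriv2_eq rfl hF.contDiff.continuous hF.exp_eq

end IsC2LiftOf

theorem HasC2Lift.continuous {f : Circle → Circle} (hf : HasC2Lift f) : Continuous f := by
  obtain ⟨F, hF⟩ := hf.exists_lift
  rw [isQuotientMap_circleExp.continuous_iff,
    show f ∘ Circle.exp = Circle.exp ∘ F from funext fun x => (hF.exp_eq x).symm]
  exact Circle.exp.continuous.comp hF.contDiff.continuous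

theorem HasC2Lift.continuous_angularDeriv {f : Circle → Circle} (hf : HasC2Lift f) :
    Continuous (angularDeriv f) := by
  obtain ⟨F, hF⟩ := hf.exists_lift
  rw [isQuotientMap_circleExp.continuous_iff,
    show angularDeriv f ∘ Circle.exp = deriv F from funext hF.angularDeriv_exp]
  exact hF.contDiff_deriv.continuous

theorem HasC2Lift.continuous_angularDeriv2 {f : Circle → Circle} (hf : HasC2Lift f) :
    Continuous (angularDeriv2 f) := by
  obtain ⟨F, hF⟩ := hf.exists_lift
  rw [isQuotientMap_circleExp.continuous_iff,
    show angularDeriv2 f ∘ Circle.exp = deriv (deriv F) from funext hF.angularDeriv2_exp]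
  exact hF.contDiff_deriv.continuous_deriv le_rfl

/-! ### Chain rules -/

theorem angularDeriv_comp {f g : Circle → Circle} (hg : HasC2Lift g) (hf : HasC2Lift f)
    (z : Circle) : angularDeriv (g ∘ f) z = angularDeriv g (f z) * angularDeriv f z := by
  obtain ⟨F, hF⟩ := hf.exists_lift
  obtain ⟨G, hG⟩ := hg.exists_lift
  obtain ⟨x, rfl⟩ := Circle.exp_surjective z
  rw [angularDeriv_eq (F := G ∘ F) rfl (hG.contDiff.continuous.comp hF.contDiff.continuous)
      (fun y => by simp [hG.exp_eq, hF.exp_eq]), ← hF.exp_eq, hG.angularDeriv_exp,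
    hF.angularDeriv_exp]
  exact ((hG.hasDerivAt _).comp x (hF.hasDerivAt x)).deriv

theorem angularDeriv2_comp {f g : Circle → Circle} (hg : HasC2Lift g) (hf : HasC2Lift f)
    (z : Circle) : angularDeriv2 (g ∘ f) z =
      angularDeriv2 g (f z) * angularDeriv f z ^ 2 + angularDeriv g (f z) * angularDeriv2 f z := by
  obtain ⟨F, hF⟩ := hf.exists_lift
  obtain ⟨G, hG⟩ := hg.exists_lift
  obtain ⟨x, rfl⟩ := Circle.exp_surjective z
  rw [angularDeriv2_eq (F := G ∘ F) rfl (hG.contDiff.continuous.comp hF.contDiff.continuous)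
      (fun y => by simp [hG.exp_eq, hF.exp_eq]), ← hF.exp_eq, hG.angularDeriv_exp,
    hG.angularDeriv2_exp, hF.angularDeriv_exp, hF.angularDeriv2_exp]
  have h : deriv (G ∘ F) = fun y => deriv G (F y) * deriv F y :=
    funext fun y => ((hG.hasDerivAt _).comp y (hF.hasDerivAt y)).deriv
  rw [h]
  refine (((hG.hasDerivAt_deriv (F x)).comp x (hF.hasDerivAt x)).mul
    (hF.hasDerivAt_deriv x)).deriv.trans ?_
  simp only [Function.comp_apply]
  ring

theorem SameTwoJet.comp {P f Q g : Circle → Circle} {z : Circle} (hP : HasC2Lift P)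
    (hf : HasC2Lift f) (hQ : HasC2Lift Q) (hg : HasC2Lift g) (h : SameTwoJet P f z)
    (h' : SameTwoJet Q g (f z)) : SameTwoJet (Q ∘ P) (g ∘ f) z := by
  obtain ⟨h0, h1, h2⟩ := h
  obtain ⟨h0', h1', h2'⟩ := h'
  refine ⟨by simp [h0, h0'], ?_, ?_⟩
  · rw [angularDeriv_comp hQ hP, angularDeriv_comp hg hf, h0, h1, h1']
  · rw [angularDeriv2_comp hQ hP, angularDeriv2_comp hg hf, h0, h1, h1', h2, h2']

theorem SameTwoJet.refl (f : Circle → Circle) (z : Circle) : SameTwoJet f f z := ⟨rfl, rfl, rfl⟩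

/-! ### Möbius transformations as `C²` diffeomorphisms -/

/-- The quantity is the Poisson kernel `(1 - |s|²) / |1 - s|²`; it occurs as the derivative of
`mobiusLift`. -/
theorem two_mul_re_inv_one_sub_pos {s : ℂ} (hs : ‖s‖ < 1) : 0 < 2 * (1 - s)⁻¹.re - 1 := by
  have h0 : 0 < Complex.normSq (1 - s) := Complex.normSq_pos.2 (one_sub_ne_zero_of_norm_lt hs)
  have h1 : Complex.normSq s < 1 := by
    rw [Complex.normSq_eq_norm_sq]
    nlinarith [norm_nonneg s]
  rw [Complex.inv_re, sub_pos, mul_div_assoc', one_lt_div h0]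
  simp only [Complex.normSq_apply, Complex.sub_re, Complex.sub_im, Complex.one_re,
    Complex.one_im] at *
  linarith

theorem contDiff_mobiusLift {σ : ℂ} (hσ : ‖σ‖ < 1) (k : ℝ) : ContDiff ℝ 2 (mobiusLift k σ) := by
  have h0 : ContDiff ℝ 2 fun x : ℝ => 1 - σ * Complex.exp (-(x * Complex.I)) := by
    have : ContDiff ℝ 2 fun x : ℝ => (x : ℂ) := Complex.ofRealCLM.contDiff
    fun_prop
  have h1 : ContDiff ℝ 2 fun x : ℝ => Complex.log (1 - σ * Complex.exp (-(x * Complex.I))) := by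
    rw [contDiff_iff_contDiffAt]
    intro x
    exact ((Complex.contDiffAt_log (one_sub_mem_slitPlane (norm_mul_exp_lt hσ x))).restrict_scalars
      ℝ).comp x h0.contDiffAt
  have h2 := Complex.imCLM.contDiff.comp h1
  exact (contDiff_const.add contDiff_id).add (contDiff_const.mul h2)

theorem IsMobiusWith.hasC2Lift {f : Circle → Circle} {c : Circle} {σ : ℂ}
    (hf : IsMobiusWith f c σ) : HasC2Lift f := by
  obtain ⟨k, rfl⟩ := Circle.exp_surjective c
  refine ⟨_, contDiff_mobiusLift hf.1 k, fun x => ?_, exp_mobiusLift hf⟩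
  rw [(hasDerivAt_mobiusLift hf.1 k x).deriv]
  exact two_mul_re_inv_one_sub_pos (norm_mul_exp_lt hf.1 x)

theorem Mobius.hasC2Lift (P : Mobius) : HasC2Lift P.1 := by
  obtain ⟨c, σ, hP⟩ := P.2
  exact hP.hasC2Lift

theorem isMobiusWith_const_mul (c : Circle) : IsMobiusWith (fun z => c * z) c 0 :=
  ⟨by simp, fun z => by simp⟩

/-! ### The projective cocycle and its continuity -/

theorem projectiveDerivative_spec (f : CircleDiff2) (z : Circle) :
    SameTwoJet (projectiveDerivative f z).1 f.1 z :=
  (existsUnique_sameTwoJet f z).choose_spec.1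

theorem eq_projectiveDerivative {f : CircleDiff2} {z : Circle} {P : Mobius}
    (h : SameTwoJet P.1 f.1 z) : P = projectiveDerivative f z :=
  (existsUnique_sameTwoJet f z).unique h (projectiveDerivative_spec f z)

theorem projectiveDerivative_mul (g f : CircleDiff2) (z : Circle) :
    projectiveDerivative (g * f) z =
      projectiveDerivative g (f • z) * projectiveDerivative f z :=
  (eq_projectiveDerivative (f := g * f) (SameTwoJet.comp (P := (projectiveDerivative f z).1)
    (f := f.1) (Q := (projectiveDerivative g (f • z)).1) (g := g.1) (Mobius.hasC2Lift _) f.2.1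
    (Mobius.hasC2Lift _) g.2.1 (projectiveDerivative_spec f z)
    (projectiveDerivative_spec g (f • z)))).symm

theorem projectiveDerivative_mem_rotationSubgroup {f : CircleDiff2} {c : Circle}
    (hf : ∀ z : Circle, f • z = c * z) (z : Circle) :
    projectiveDerivative f z ∈ rotationSubgroup := by
  have h : IsMobiusWith f.1 c 0 := by
    rw [show (f.1 : Circle → Circle) = fun z => c * z from funext hf]
    exact isMobiusWith_const_mul c
  have h' : (⟨f.1, c, 0, h⟩ : Mobius) = projectiveDerivative f z :=
    eq_projectiveDerivative (SameTwoJet.refl _ _)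
  rw [← h']
  exact ⟨c, hf⟩

/-- The number `(1 - σ / z)⁻¹` of the Möbius transformation with parameter `σ` that has the
2-jet of `f` at `z`. -/
def jetNumber (f : Circle → Circle) (z : Circle) : ℂ :=
  ((1 + angularDeriv f z) / 2 : ℝ) + (angularDeriv2 f z / (2 * angularDeriv f z) : ℝ) * Complex.I

theorem HasC2Lift.jetNumber_ne_zero {f : Circle → Circle} (hf : HasC2Lift f) (z : Circle) :
    jetNumber f z ≠ 0 := by
  intro h
  have h0 := hf.angularDeriv_pos z
  have := congrArg Complex.re h
  rw [jetNumber] at this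
  simp only [Complex.add_re, Complex.ofReal_re, Complex.re_ofReal_mul, Complex.I_re, mul_zero,
    Complex.zero_re] at this
  linarith

theorem HasC2Lift.continuous_jetNumber {f : Circle → Circle} (hf : HasC2Lift f) :
    Continuous (jetNumber f) := by
  have h1 := hf.continuous_angularDeriv
  have h2 := hf.continuous_angularDeriv2
  have h3 : Continuous fun z => angularDeriv2 f z / (2 * angularDeriv f z) :=
    h2.div (by fun_prop) fun z => (mul_pos two_pos (hf.angularDeriv_pos z)).ne'
  unfold jetNumber
  fun_prop

/-- Inverts the formulas `D = 2 Re w - 1` and `D² = 2 D Im w` for `w = (1 - σ / z)⁻¹`. The jet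
number at `z` therefore determines `σ`. -/
theorem IsMobiusWith.inv_one_sub_eq_jetNumber {f : Circle → Circle} {c : Circle} {σ : ℂ}
    (hf : IsMobiusWith f c σ) (z : Circle) : (1 - σ * conj (z : ℂ))⁻¹ = jetNumber f z := by
  have h0 := hf.hasC2Lift.angularDeriv_pos z
  obtain ⟨h1, h2⟩ := hf.angularDeriv_eq z
  rw [← h1] at h2
  rw [h1] at h0
  rw [jetNumber, h2, h1]
  generalize (1 - σ * conj (z : ℂ))⁻¹ = w at *
  have e1 : (1 + (2 * w.re - 1)) / 2 = w.re := by ring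
  have e2 : 2 * (2 * w.re - 1) * w.im / (2 * (2 * w.re - 1)) = w.im := by field_simp
  rw [e1, e2, Complex.re_add_im]

theorem SameTwoJet.jetNumber_eq {P f : Circle → Circle} {z : Circle} (h : SameTwoJet P f z) :
    jetNumber P z = jetNumber f z := by
  rw [jetNumber, jetNumber, h.2.1, h.2.2]

/-- An explicit formula for the Möbius transformation with the 2-jet of `f` at `z`. -/
theorem projectiveDerivative_apply (f : CircleDiff2) (z x : Circle) :
    ((projectiveDerivative f z).1 x : ℂ) =
      f.1 z * conj (jetNumber f.1 z)⁻¹ / (z * (jetNumber f.1 z)⁻¹) *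
        ((x - z * (1 - (jetNumber f.1 z)⁻¹)) / (1 - conj (z * (1 - (jetNumber f.1 z)⁻¹)) * x)) := by
  obtain ⟨c, σ, hP⟩ := (projectiveDerivative f z).2
  have h0 := (projectiveDerivative_spec f z).1
  have hw := hP.inv_one_sub_eq_jetNumber z
  have hw0 : jetNumber f.1 z ≠ 0 := f.2.1.jetNumber_ne_zero z
  have hz := Circle.coe_mul_conj z
  have hz0 := Circle.coe_ne_zero z
  rw [(projectiveDerivative_spec f z).jetNumber_eq, inv_eq_iff_eq_inv] at hw
  set v := (jetNumber f.1 z)⁻¹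
  have hv0 : v ≠ 0 := inv_ne_zero hw0
  have hσ : σ = z * (1 - v) := by
    rw [← hw]
    linear_combination (-σ) * hz
  have hPz := hP.2 z
  have hd : (1 : ℂ) - conj (z * (1 - v)) * z = conj v := by
    simp only [map_mul, map_sub, map_one]
    linear_combination (conj v - 1) * hz
  rw [h0, hσ, hd, show (z : ℂ) - z * (1 - v) = z * v by ring] at hPz
  have hcv : conj v ≠ 0 := (map_ne_zero _).2 hv0
  have hc : (c : ℂ) = f.1 z * conj v / (z * v) := by
    rw [hPz]
    field_simp
  rw [hP.2 x, hσ, hc]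

/-- In the compact-open topology, joint continuity in base point and argument suffices, and the
explicit formula shows it. -/
theorem continuous_projectiveDerivative (f : CircleDiff2) :
    Continuous (projectiveDerivative f) := by
  refine continuous_induced_rng.2 (ContinuousMap.continuous_of_continuous_uncurry _ ?_)
  refine Continuous.subtype_mk (f := fun q : Circle × Circle =>
    ((projectiveDerivative f q.1).1 q.2 : ℂ)) ?_ _
  simp only [projectiveDerivative_apply]
  have h0 : ∀ z, jetNumber f.1 z ≠ 0 := f.2.1.jetNumber_ne_zero
  have h1 : Continuous fun q : Circle × Circle => (jetNumber f.1 q.1)⁻¹ :=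
    (f.2.1.continuous_jetNumber.comp continuous_fst).inv₀ fun q => h0 _
  have h2 : Continuous fun q : Circle × Circle => conj (jetNumber f.1 q.1)⁻¹ :=
    Complex.continuous_conj.comp h1
  have h3 : Continuous fun q : Circle × Circle => (f.1 q.1 : ℂ) :=
    continuous_subtype_val.comp (f.1.continuous.comp continuous_fst)
  have h4 : Continuous fun q : Circle × Circle =>
      conj ((q.1 : ℂ) * (1 - (jetNumber f.1 q.1)⁻¹)) :=
    Complex.continuous_conj.comp (by fun_prop)
  refine ((h3.mul h2).div (by fun_prop) fun q => ?_).mul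
    (Continuous.div (by fun_prop) (by fun_prop) fun q => ?_)
  · exact mul_ne_zero (Circle.coe_ne_zero _) (inv_ne_zero (h0 _))
  -- The number `z * (1 - (jetNumber f z)⁻¹)` is the parameter `σ` of the projective derivative,
  -- hence of norm less than one.
  · refine one_sub_conj_mul_ne_zero ?_ q.2
    obtain ⟨c, σ, hP⟩ := (projectiveDerivative f q.1).2
    have hw := hP.inv_one_sub_eq_jetNumber q.1
    rw [(projectiveDerivative_spec f q.1).jetNumber_eq, inv_eq_iff_eq_inv] at hw
    rw [← hw, sub_sub_cancel, norm_mul, norm_mul, Complex.norm_conj, Circle.norm_coe, one_mul,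
      mul_one]
    exact hP.1

theorem isReducible_of_isC2ConjugateToRotations {Γ : Subgroup CircleDiff2}
    (h : IsC2ConjugateToRotations Γ) :
    IsReducible (fun (f : Γ) (z : Circle) => projectiveDerivative (f : CircleDiff2) z)
      rotationSubgroup := by
  obtain ⟨φ, hφ⟩ := h
  refine ⟨⟨projectiveDerivative φ, continuous_projectiveDerivative φ⟩, fun f z => ?_⟩
  obtain ⟨c, hc⟩ := hφ f f.2
  -- Two factorisations of `φ * f`, as `(φ * f * φ⁻¹) * φ` and as `φ` after `f`, are compared by the
  -- chain rule.
  have key := projectiveDerivative_mul (φ * f * φ⁻¹) φ z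
  rw [inv_mul_cancel_right, projectiveDerivative_mul] at key
  change projectiveDerivative φ ((f : CircleDiff2) • z) * _ * _ ∈ _
  rw [ContinuousMap.coe_mk, key, mul_inv_cancel_right]
  exact projectiveDerivative_mem_rotationSubgroup hc _

/-! ### Continuity of the 2-jets of a continuous family of Möbius transformations -/

/-- The mean value of a map of the circle. -/
def circleMean (f : Circle → Circle) : ℂ :=
  -- The value `0` off the unit circle never enters the average.
  Real.circleAverage (fun w => if h : ‖w‖ = 1 then
    (f ⟨w, by simpa [Submonoid.unitSphere] using h⟩ : ℂ) else 0) 0 1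

theorem circleMean_eq_integral (f : Circle → Circle) :
    circleMean f = (2 * Real.pi)⁻¹ • ∫ t in (0 : ℝ)..2 * Real.pi, (f (Circle.exp t) : ℂ) := by
  rw [circleMean, Real.circleAverage_def]
  congr 2
  funext t
  have h : ‖circleMap 0 1 t‖ = 1 := by simp
  rw [dif_pos h]
  congr 2
  apply Subtype.ext
  simp [circleMap]

/-- The Möbius map is holomorphic on the closed disc, so its mean over the circle is its value at
the centre. -/
theorem IsMobiusWith.circleMean_eq {f : Circle → Circle} {c : Circle} {σ : ℂ}
    (hf : IsMobiusWith f c σ) : circleMean f = -(c * σ) := by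
  have hd : DiffContOnCl ℂ (fun w : ℂ => c * ((w - σ) / (1 - conj σ * w)))
      (Metric.ball 0 |(1 : ℝ)|) := by
    apply DifferentiableOn.diffContOnCl
    intro w hw
    have hw' : ‖w‖ ≤ 1 := by
      simpa using Metric.closure_ball_subset_closedBall hw
    have h0 : 1 - conj σ * w ≠ 0 := by
      apply one_sub_ne_zero_of_norm_lt
      rw [norm_mul, Complex.norm_conj]
      exact mul_lt_one_of_nonneg_of_lt_one_left (norm_nonneg σ) hf.1 hw'
    apply DifferentiableAt.differentiableWithinAt
    fun_prop (disch := exact h0)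
  have h := hd.circleAverage
  rw [circleMean, ← show (c : ℂ) * ((0 - σ) / (1 - conj σ * 0)) = -(c * σ) by simp, ← h]
  apply Real.circleAverage_congr_sphere
  intro w hw
  have hw' : ‖w‖ = 1 := by simpa using hw
  simp only [dif_pos hw']
  exact hf.2 _

theorem IsMobiusWith.norm_circleMean_lt {f : Circle → Circle} {c : Circle} {σ : ℂ}
    (hf : IsMobiusWith f c σ) : ‖circleMean f‖ < 1 := by
  rw [hf.circleMean_eq]
  exact norm_neg_circle_mul_lt hf.1

/-- Expresses the 2-jet without derivatives, by the mean and one value of the map; both are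
continuous under uniform convergence. -/
theorem IsMobiusWith.jetNumber_eq {f : Circle → Circle} {c : Circle} {σ : ℂ}
    (hf : IsMobiusWith f c σ) (z : Circle) :
    jetNumber f z = (1 - circleMean f * conj (f z : ℂ)) /
      (1 - circleMean f * conj (circleMean f)) := by
  have h1 : (1 : ℂ) - σ * conj (z : ℂ) ≠ 0 :=
    one_sub_ne_zero_of_norm_lt (by
      rw [norm_mul, Complex.norm_conj, Circle.norm_coe, mul_one]
      exact hf.1)
  have h2 : (1 : ℂ) - σ * conj σ ≠ 0 :=
    one_sub_ne_zero_of_norm_lt (by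
      rw [norm_mul, Complex.norm_conj]
      exact mul_lt_one_of_nonneg_of_lt_one_left (norm_nonneg σ) hf.1 hf.1.le)
  have hc := Circle.coe_mul_conj c
  rw [← hf.inv_one_sub_eq_jetNumber, hf.circleMean_eq, hf.2]
  simp only [map_neg, map_mul, map_div₀, map_sub, map_one, Complex.conj_conj]
  have h3 : (1 : ℂ) - -(c * σ) * -(conj (c : ℂ) * conj σ) = 1 - σ * conj σ := by
    linear_combination (-σ * conj σ) * hc
  have h4 : (1 : ℂ) -
      -(c * σ) * (conj (c : ℂ) * ((conj (z : ℂ) - conj σ) / (1 - σ * conj (z : ℂ)))) =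
      (1 - σ * conj σ) / (1 - σ * conj (z : ℂ)) := by
    field_simp
    linear_combination (σ * (conj (z : ℂ) - conj σ)) * hc
  rw [h3, h4]
  field_simp

theorem continuous_eval_mobius (B : C(Circle, Mobius)) :
    Continuous fun q : Circle × Circle => (B q.1).1 q.2 := by
  have h : Continuous fun z => (⟨(B z).1, (B z).1.continuous⟩ : C(Circle, Circle)) :=
    continuous_induced_dom.comp B.continuous
  exact (h.comp continuous_fst).eval continuous_snd

theorem continuous_jetNumber_mobius (B : C(Circle, Mobius)) :
    Continuous fun z => jetNumber (B z).1 z := by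
  have hB := continuous_eval_mobius B
  have h1 : Continuous fun z => circleMean (B z).1 := by
    simp only [circleMean_eq_integral]
    have hi : Continuous fun z => ∫ t in (0 : ℝ)..2 * Real.pi, ((B z).1 (Circle.exp t) : ℂ) :=
      intervalIntegral.continuous_parametric_intervalIntegral_of_continuous'
        (f := fun (z : Circle) (t : ℝ) => ((B z).1 (Circle.exp t) : ℂ))
        (continuous_subtype_val.comp
          (hB.comp (continuous_fst.prodMk (Circle.exp.continuous.comp continuous_snd)))) _ _
    exact hi.const_smul (2 * Real.pi)⁻¹
  have h2 : Continuous fun z => conj ((B z).1 z : ℂ) :=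
    Complex.continuous_conj.comp (continuous_subtype_val.comp
      (hB.comp (continuous_id.prodMk continuous_id)))
  have h3 : Continuous fun z => conj (circleMean (B z).1) := Complex.continuous_conj.comp h1
  have h : (fun z => jetNumber (B z).1 z) = fun z =>
      (1 - circleMean (B z).1 * conj ((B z).1 z : ℂ)) /
      (1 - circleMean (B z).1 * conj (circleMean (B z).1)) := by
    funext z
    obtain ⟨c, σ, hP⟩ := (B z).2
    exact hP.jetNumber_eq z
  rw [h]
  refine Continuous.div (by fun_prop) (by fun_prop) fun z => ?_
  obtain ⟨c, σ, hP⟩ := (B z).2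
  apply one_sub_ne_zero_of_norm_lt
  rw [norm_mul, Complex.norm_conj]
  exact mul_lt_one_of_nonneg_of_lt_one_left (norm_nonneg _) hP.norm_circleMean_lt
    hP.norm_circleMean_lt.le

/-! ### The invariant density and connection of a reduction -/

theorem angularDeriv_eq_jetNumber (f : Circle → Circle) (z : Circle) :
    angularDeriv f z = 2 * (jetNumber f z).re - 1 := by
  simp only [jetNumber, Complex.add_re, Complex.ofReal_re, Complex.re_ofReal_mul, Complex.I_re]
  ring

theorem angularDeriv2_div_eq_jetNumber (f : Circle → Circle) (z : Circle) :
    angularDeriv2 f z / angularDeriv f z = 2 * (jetNumber f z).im := by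
  simp only [jetNumber, Complex.add_im, Complex.ofReal_im, Complex.im_ofReal_mul, Complex.I_im]
  rw [div_mul_eq_div_div_swap]
  ring

theorem angularDeriv_comp_of_rotation {R f : Circle → Circle} {c : Circle} (hf : HasC2Lift f)
    (hR : ∀ z, R z = c * z) (z : Circle) : angularDeriv (R ∘ f) z = angularDeriv f z ∧
      angularDeriv2 (R ∘ f) z = angularDeriv2 f z := by
  obtain rfl : R = fun z => c * z := funext hR
  have hc := isMobiusWith_const_mul c
  obtain ⟨h1, h2⟩ := hc.angularDeriv_eq (f z)
  norm_num at h1 h2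
  rw [angularDeriv_comp hc.hasC2Lift hf, angularDeriv2_comp hc.hasC2Lift hf, h1, h2]
  constructor <;> ring

/-- A reduction of the projective cocycle to the rotations yields a continuous invariant density
and a continuous invariant affine connection. -/
theorem exists_invariant_of_isReducible {Γ : Subgroup CircleDiff2}
    (h : IsReducible (fun (f : Γ) (z : Circle) => projectiveDerivative (f : CircleDiff2) z)
      rotationSubgroup) :
    ∃ a b : Circle → ℝ, Continuous a ∧ Continuous b ∧ (∀ z, 0 < a z) ∧
      (∀ f ∈ Γ, ∀ z, a (f.1 z) * angularDeriv f.1 z = a z) ∧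
      ∀ f ∈ Γ, ∀ z, b (f.1 z) * angularDeriv f.1 z + angularDeriv2 f.1 z / angularDeriv f.1 z =
        b z := by
  obtain ⟨B, hB⟩ := h
  have hpos : ∀ z, 0 < angularDeriv (B z).1 z := fun z => (Mobius.hasC2Lift (B z)).angularDeriv_pos z
  have key : ∀ f ∈ Γ, ∀ z,
      angularDeriv (B (f.1 z)).1 (f.1 z) * angularDeriv f.1 z = angularDeriv (B z).1 z ∧
      angularDeriv2 (B (f.1 z)).1 (f.1 z) * angularDeriv f.1 z ^ 2 +
        angularDeriv (B (f.1 z)).1 (f.1 z) * angularDeriv2 f.1 z = angularDeriv2 (B z).1 z := by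
    intro f hf z
    obtain ⟨c, hc⟩ := hB ⟨f, hf⟩ z
    obtain ⟨j0, j1, j2⟩ := projectiveDerivative_spec f z
    set P := projectiveDerivative f z
    -- Reducibility says that `R` is a rotation. The 2-jet at `z` of `R ∘ B z = B (f z) ∘ P` is then
    -- computed in two ways, with the jet of `P` replaced by that of `f`.
    set R : Mobius := B (f.1 z) * P * (B z)⁻¹ with hR
    have hc' : ∀ w, R.1 w = c * w := hc
    have e : R.1 ∘ (B z).1 = (B (f.1 z)).1 ∘ P.1 := by
      have : R * B z = B (f.1 z) * P := by rw [hR, inv_mul_cancel_right]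
      exact congrArg (fun Q : Mobius => (Q.1 : Circle → Circle)) this
    obtain ⟨h1, h2⟩ := angularDeriv_comp_of_rotation (Mobius.hasC2Lift (B z)) hc' z
    rw [e, angularDeriv_comp (Mobius.hasC2Lift _) (Mobius.hasC2Lift P), j0, j1] at h1
    rw [e, angularDeriv2_comp (Mobius.hasC2Lift _) (Mobius.hasC2Lift P), j0, j1, j2] at h2
    exact ⟨h1, h2⟩
  have hj := continuous_jetNumber_mobius B
  refine ⟨fun z => angularDeriv (B z).1 z,
    fun z => angularDeriv2 (B z).1 z / angularDeriv (B z).1 z, ?_, ?_, hpos,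
    fun f hf z => (key f hf z).1, fun f hf z => ?_⟩
  · simp only [angularDeriv_eq_jetNumber]
    exact (continuous_const.mul (Complex.continuous_re.comp hj)).sub continuous_const
  · simp only [angularDeriv2_div_eq_jetNumber]
    exact continuous_const.mul (Complex.continuous_im.comp hj)
  · obtain ⟨h1, h2⟩ := key f hf z
    have hf0 := (f.2.1.angularDeriv_pos z).ne'
    have hb0 := (hpos (f.1 z)).ne'
    simp only
    rw [← h1, ← h2]
    field_simp

/-! ### Circle maps of degree one and their lifts -/

theorem map_add_int_mul_two_pi {Φ : ℝ → ℝ} (hΦ : ∀ x, Φ (x + 2 * Real.pi) = Φ x + 2 * Real.pi)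
    (n : ℤ) (x : ℝ) : Φ (x + n * (2 * Real.pi)) = Φ x + n * (2 * Real.pi) := by
  have h : Function.Periodic (fun x => Φ x - x) (2 * Real.pi) := fun x => by
    simp only [hΦ]
    ring
  linarith [h.int_mul n x]

/-- The circle map with the lift `Φ` of degree one. -/
def circleMapOfLift (Φ : ℝ → ℝ) (z : Circle) : Circle := Circle.exp (Φ (Complex.arg z))

section circleMapOfLift

variable {Φ : ℝ → ℝ} (hΦ : ∀ x, Φ (x + 2 * Real.pi) = Φ x + 2 * Real.pi)

include hΦ

/-- The branch of `Complex.arg` is immaterial: angles of one point differ by a multiple of `2π`,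
which a lift of degree one preserves. -/
theorem circleMapOfLift_exp (x : ℝ) : circleMapOfLift Φ (Circle.exp x) = Circle.exp (Φ x) := by
  obtain ⟨m, hm⟩ := Circle.exp_eq_exp.1 (Circle.exp_arg (Circle.exp x))
  rw [circleMapOfLift, hm, map_add_int_mul_two_pi hΦ]
  exact Circle.exp_eq_exp.2 ⟨m, rfl⟩

theorem circleMapOfLift_injective (hinj : Function.Injective Φ) :
    Function.Injective (circleMapOfLift Φ) := by
  intro z w h
  obtain ⟨x, rfl⟩ := Circle.exp_surjective z
  obtain ⟨y, rfl⟩ := Circle.exp_surjective w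
  rw [circleMapOfLift_exp hΦ, circleMapOfLift_exp hΦ, Circle.exp_eq_exp] at h
  obtain ⟨m, hm⟩ := h
  rw [← map_add_int_mul_two_pi hΦ] at hm
  exact Circle.exp_eq_exp.2 ⟨m, hinj hm⟩

theorem surjective_of_continuous_of_degree_one (hc : Continuous Φ) : Function.Surjective Φ := by
  intro y
  refine mem_range_of_exists_le_of_exists_ge hc ?_ ?_
  · obtain ⟨n, hn⟩ := exists_int_lt ((y - Φ 0) / (2 * Real.pi))
    rw [lt_div_iff₀ Real.two_pi_pos] at hn
    exact ⟨0 + n * (2 * Real.pi), by rw [map_add_int_mul_two_pi hΦ]; linarith⟩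
  · obtain ⟨n, hn⟩ := exists_int_gt ((y - Φ 0) / (2 * Real.pi))
    rw [div_lt_iff₀ Real.two_pi_pos] at hn
    exact ⟨0 + n * (2 * Real.pi), by rw [map_add_int_mul_two_pi hΦ]; linarith⟩

/-- An increasing homeomorphism of the line with prescribed derivative. -/
theorem exists_homeomorph_eq {r : ℝ → ℝ} (hr : ∀ x, 0 < r x) (hd : ∀ x, HasDerivAt Φ (r x) x) :
    ∃ e : ℝ ≃ₜ ℝ, ∀ x, e x = Φ x := by
  have hc : Continuous Φ := continuous_iff_continuousAt.2 fun x => (hd x).continuousAt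
  have hm : StrictMono Φ := strictMono_of_deriv_pos fun x => by
    rw [(hd x).deriv]
    exact hr x
  exact ⟨(hm.orderIsoOfSurjective Φ (surjective_of_continuous_of_degree_one hΦ hc)).toHomeomorph,
    fun x => rfl⟩

theorem exists_circleDiff2_of_lift {r : ℝ → ℝ} (hr : ∀ x, 0 < r x)
    (hd : ∀ x, HasDerivAt Φ (r x) x) (hC : ContDiff ℝ 2 Φ) :
    ∃ φ : CircleDiff2, ∀ x : ℝ, φ • Circle.exp x = Circle.exp (Φ x) := by
  obtain ⟨e, he⟩ := exists_homeomorph_eq hΦ hr hd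
  obtain rfl : (e : ℝ → ℝ) = Φ := funext he
  have hΨ : ∀ y, e.symm (y + 2 * Real.pi) = e.symm y + 2 * Real.pi := fun y => by
    rw [e.symm_apply_eq, hΦ, e.apply_symm_apply]
  have hds : ∀ y, HasDerivAt e.symm (r (e.symm y))⁻¹ y := fun y =>
    HasDerivAt.of_local_left_inverse e.symm.continuous.continuousAt (hd _) (hr _).ne'
      (Filter.Eventually.of_forall e.apply_symm_apply)
  have hCs : ContDiff ℝ 2 e.symm := e.contDiff_symm_deriv (fun x => (hr x).ne') hd hC
  have h1 : HasC2Lift (circleMapOfLift e) := ⟨e, hC, fun x => by rw [(hd x).deriv]; exact hr x,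
    fun x => (circleMapOfLift_exp hΦ x).symm⟩
  have h2 : HasC2Lift (circleMapOfLift e.symm) := ⟨e.symm, hCs,
    fun x => by rw [(hds x).deriv]; exact inv_pos.2 (hr _),
    fun x => (circleMapOfLift_exp hΨ x).symm⟩
  refine ⟨⟨⟨⟨circleMapOfLift e, circleMapOfLift e.symm, fun z => ?_, fun z => ?_⟩,
    h1.continuous, h2.continuous⟩, h1, h2⟩, circleMapOfLift_exp hΦ⟩
  · obtain ⟨x, rfl⟩ := Circle.exp_surjective z
    rw [circleMapOfLift_exp hΦ, circleMapOfLift_exp hΨ, e.symm_apply_apply]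
  · obtain ⟨x, rfl⟩ := Circle.exp_surjective z
    rw [circleMapOfLift_exp hΨ, circleMapOfLift_exp hΦ, e.apply_symm_apply]

end circleMapOfLift

/-! ### Invariant densities -/

theorem hasDerivAt_integral_of_continuous {g : ℝ → ℝ} (hg : Continuous g) (x : ℝ) :
    HasDerivAt (fun y => ∫ t in (0 : ℝ)..y, g t) (g x) x :=
  intervalIntegral.integral_hasDerivAt_right (hg.intervalIntegrable _ _)
    (hg.stronglyMeasurableAtFilter _ _) hg.continuousAt

theorem contDiff_one_of_hasDerivAt {f f' : ℝ → ℝ} (h : ∀ x, HasDerivAt f (f' x) x)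
    (hf' : Continuous f') : ContDiff ℝ 1 f := by
  rw [contDiff_one_iff_deriv, show deriv f = f' from funext fun x => (h x).deriv]
  exact ⟨fun x => (h x).differentiableAt, hf'⟩

theorem exists_eq_const_of_hasDerivAt_zero {f : ℝ → ℝ} (h : ∀ x, HasDerivAt f 0 x) :
    ∃ c, ∀ x, f x = c :=
  ⟨f 0, fun x => is_const_of_deriv_eq_zero (fun y => (h y).differentiableAt)
    (fun y => (h y).deriv) x 0⟩

/-- The circle map of degree one that straightens a given density. -/
theorem exists_lift_of_density {a : Circle → ℝ} (ha : Continuous a) (hpos : ∀ z, 0 < a z) :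
    ∃ (Φ : ℝ → ℝ) (k : ℝ), 0 < k ∧ (∀ x, HasDerivAt Φ (k * a (Circle.exp x)) x) ∧
      ∀ x, Φ (x + 2 * Real.pi) = Φ x + 2 * Real.pi := by
  set g : ℝ → ℝ := fun x => a (Circle.exp x) with hg
  have hgc : Continuous g := ha.comp Circle.exp.continuous
  have hper : Function.Periodic g (2 * Real.pi) := fun x => by simp only [hg, Circle.periodic_exp x]
  have hI : 0 < ∫ t in (0 : ℝ)..2 * Real.pi, g t :=
    intervalIntegral.intervalIntegral_pos_of_pos (hgc.intervalIntegrable _ _) (fun x => hpos _)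
      Real.two_pi_pos
  set I := ∫ t in (0 : ℝ)..2 * Real.pi, g t with hIdef
  -- The factor `2π / I` gives the density total mass `2π`, so that its primitive has degree one.
  refine ⟨fun x => 2 * Real.pi / I * ∫ t in (0 : ℝ)..x, g t, 2 * Real.pi / I,
    div_pos Real.two_pi_pos hI, fun x => (hasDerivAt_integral_of_continuous hgc x).const_mul _,
    fun x => ?_⟩
  have h1 := intervalIntegral.integral_add_adjacent_intervals (hgc.intervalIntegrable 0 x)
    (hgc.intervalIntegrable (μ := MeasureTheory.volume) x (x + 2 * Real.pi))
  have h2 := hper.intervalIntegral_add_eq x 0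
  rw [zero_add] at h2
  simp only
  rw [← h1, h2, ← hIdef]
  field_simp

/-- Invariance of the density says exactly that `Φ ∘ F` and `Φ` have the same derivative. -/
theorem exists_translation_of_density {a : Circle → ℝ} {Φ F : ℝ → ℝ} {f : Circle → Circle} {k : ℝ}
    (hd : ∀ x, HasDerivAt Φ (k * a (Circle.exp x)) x) (hF : IsC2LiftOf F f)
    (hinv : ∀ z, a (f z) * angularDeriv f z = a z) : ∃ t, ∀ x, Φ (F x) = Φ x + t := by
  have h : ∀ x, HasDerivAt (fun x => Φ (F x) - Φ x) 0 x := fun x => by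
    refine (((hd (F x)).comp x (hF.hasDerivAt x)).sub (hd x)).congr_deriv ?_
    rw [hF.exp_eq, ← hF.angularDeriv_exp, ← hinv (Circle.exp x)]
    ring
  obtain ⟨t, ht⟩ := exists_eq_const_of_hasDerivAt_zero h
  exact ⟨t, fun x => by rw [← ht x]; ring⟩

/-- The conjugacy is the circle map with lift `Φ`, the normalised primitive of `a`; it gains one
derivative over `a`. -/
theorem isC2ConjugateToRotations_of_density {Γ : Subgroup CircleDiff2} {a : Circle → ℝ}
    (ha : ContDiff ℝ 1 fun x => a (Circle.exp x)) (hpos : ∀ z, 0 < a z)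
    (hinv : ∀ f ∈ Γ, ∀ z, a (f.1 z) * angularDeriv f.1 z = a z) : IsC2ConjugateToRotations Γ := by
  obtain ⟨Φ, k, hk, hd, hΦ⟩ :=
    exists_lift_of_density (isQuotientMap_circleExp.continuous_iff.2 ha.continuous) hpos
  have hC : ContDiff ℝ (1 + 1) Φ := by
    rw [contDiff_succ_iff_deriv]
    refine ⟨fun x => (hd x).differentiableAt, by simp, ?_⟩
    rw [funext fun x => (hd x).deriv]
    exact contDiff_const.mul ha
  obtain ⟨φ, hφ⟩ := exists_circleDiff2_of_lift hΦ (fun x => mul_pos hk (hpos _)) hd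
    (by norm_num at hC; exact hC)
  refine ⟨φ, fun f hf => ?_⟩
  obtain ⟨F, hF⟩ := f.2.1.exists_lift
  obtain ⟨t, ht⟩ := exists_translation_of_density hd hF (hinv f hf)
  refine ⟨Circle.exp t, fun z => ?_⟩
  obtain ⟨x, hx⟩ := Circle.exp_surjective (φ⁻¹ • z)
  have hz : z = φ • Circle.exp x := by rw [hx, smul_inv_smul]
  have hfx : f • Circle.exp x = Circle.exp (F x) := (hF.exp_eq x).symm
  rw [mul_smul, mul_smul, ← hx, hfx, hφ, ht, hz, hφ, Circle.exp_add, mul_comm]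

theorem isC2ConjugateToRotations_of_finite (Γ : Subgroup CircleDiff2) [Finite Γ] :
    IsC2ConjugateToRotations Γ := by
  have := Fintype.ofFinite Γ
  refine isC2ConjugateToRotations_of_density (a := fun z => ∑ f : Γ, angularDeriv f.1.1 z) ?_ ?_ ?_
  · refine ContDiff.sum fun f _ => ?_
    obtain ⟨F, hF⟩ := f.1.2.1.exists_lift
    simp only [hF.angularDeriv_exp]
    exact hF.contDiff_deriv
  · exact fun z => Finset.sum_pos (fun f _ => f.1.2.1.angularDeriv_pos z) Finset.univ_nonempty
  · intro g hg z
    rw [Finset.sum_mul]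
    -- By the chain rule, right translation by `g` permutes the summands.
    refine Fintype.sum_equiv (Equiv.mulRight ⟨g, hg⟩) _ _ fun f => ?_
    exact (angularDeriv_comp f.1.2.1 g.2.1 z).symm

/-! ### Infinite groups -/

/-- By continuity the identity extends from `A` to all `t`. Then `v - v 0` is additive and
continuous, hence linear. -/
theorem eq_affine_of_dense {v : ℝ → ℝ} (hv : Continuous v) {A : Set ℝ} (hA : Dense A)
    (h : ∀ t ∈ A, ∀ y, v (y + t) - v y = v t - v 0) : ∃ l, ∀ y, v y = v 0 + l * y := by
  have h' : ∀ y t, v (y + t) - v y = v t - v 0 := fun y t =>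
    congrFun (Continuous.ext_on hA (by fun_prop) (by fun_prop) fun t ht => h t ht y :
      (fun t => v (y + t) - v y) = fun t => v t - v 0) t
  let w : ℝ →+ ℝ := AddMonoidHom.mk' (fun y => v y - v 0) fun y t => by
    linarith [h' y t]
  refine ⟨w 1, fun y => ?_⟩
  have := map_real_smul w (show Continuous fun y => v y - v 0 by fun_prop) y 1
  simp only [smul_eq_mul, mul_one] at this
  have hw : w y = v y - v 0 := rfl
  linarith

theorem IsC2LiftOf.sub_int_mul {F : ℝ → ℝ} {f : Circle → Circle} (hF : IsC2LiftOf F f) (m : ℤ) :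
    IsC2LiftOf (fun x => F x - m * (2 * Real.pi)) f where
  contDiff := hF.contDiff.sub contDiff_const
  deriv_pos x := by
    rw [deriv_sub_const]
    exact hF.deriv_pos x
  exp_eq x := by
    rw [← hF.exp_eq]
    exact Circle.exp_eq_exp.2 ⟨-m, by push_cast; ring⟩

/-- The translations of the line that lift the conjugates by `φ` of the elements of `Γ`. -/
def translationGroup (Γ : Subgroup CircleDiff2) (φ : Circle → Circle) : AddSubgroup ℝ where
  carrier := {t | ∃ f ∈ Γ, ∀ z, φ (f.1 z) = Circle.exp t * φ z}
  zero_mem' := ⟨1, Γ.one_mem, fun z => by rw [Circle.exp_zero, one_mul]; rfl⟩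
  add_mem' := by
    rintro s t ⟨f, hf, hs⟩ ⟨g, hg, ht⟩
    refine ⟨f * g, Γ.mul_mem hf hg, fun z => ?_⟩
    rw [Circle.exp_add, mul_assoc, ← ht, ← hs]
    rfl
  neg_mem' := by
    rintro t ⟨f, hf, ht⟩
    refine ⟨f⁻¹, Γ.inv_mem hf, fun z => ?_⟩
    have h := ht ((f⁻¹).1 z)
    rw [show f.1 ((f⁻¹).1 z) = z from f.1.apply_symm_apply z] at h
    rw [h, Circle.exp_neg, inv_mul_cancel_left]

/-- A subgroup of the line is dense or cyclic. This one contains `2π`, so a generator would give a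
rotation of finite order; `Γ` would embed in the finite group of its powers, because `φ` is
injective. -/
theorem dense_translationGroup {Γ : Subgroup CircleDiff2} [Infinite Γ] {φ : Circle → Circle}
    (hφ : Function.Injective φ)
    (hΓ : ∀ f ∈ Γ, ∃ t : ℝ, ∀ z, φ (f.1 z) = Circle.exp t * φ z) :
    Dense (translationGroup Γ φ : Set ℝ) := by
  refine (translationGroup Γ φ).dense_or_cyclic.resolve_right ?_
  rintro ⟨r, hr⟩
  have hmem : ∀ t ∈ translationGroup Γ φ, ∃ n : ℤ, Circle.exp r ^ n = Circle.exp t ∧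
      (t ≠ 0 → n ≠ 0) := by
    intro t ht
    rw [hr, AddSubgroup.mem_closure_singleton] at ht
    obtain ⟨n, rfl⟩ := ht
    refine ⟨n, by rw [Circle.exp_zsmul], ?_⟩
    rintro h rfl
    simp at h
  obtain ⟨n, hn, hn0⟩ := hmem (2 * Real.pi)
    ⟨1, Γ.one_mem, fun z => by rw [Circle.exp_two_pi, one_mul]; rfl⟩
  rw [Circle.exp_two_pi] at hn
  have hfin : IsOfFinOrder (Circle.exp r) :=
    isOfFinOrder_iff_zpow_eq_one.2 ⟨n, hn0 Real.two_pi_pos.ne', hn⟩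
  have : Finite (Subgroup.zpowers (Circle.exp r)) := (finite_zpowers.2 hfin).to_subtype
  have hex : ∀ f : Γ, ∃ c : Subgroup.zpowers (Circle.exp r), ∀ z, φ (f.1.1 z) = c * φ z := by
    rintro ⟨f, hf⟩
    obtain ⟨t, ht⟩ := hΓ f hf
    obtain ⟨m, hm, -⟩ := hmem t ⟨f, hf, ht⟩
    exact ⟨⟨Circle.exp t, m, hm⟩, ht⟩
  choose c hc using hex
  refine not_injective_infinite_finite c fun f g hfg => ?_
  apply Subtype.ext
  apply Subtype.ext
  apply Homeomorph.ext
  intro z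
  apply hφ
  rw [hc, hc, hfg]

/-- Along an infinite group, an invariant density is as regular as an invariant connection
forces it to be. -/
theorem contDiff_density_of_infinite {Γ : Subgroup CircleDiff2} [Infinite Γ] {a b : Circle → ℝ}
    (ha : Continuous a) (hb : Continuous b) (hpos : ∀ z, 0 < a z)
    (hainv : ∀ f ∈ Γ, ∀ z, a (f.1 z) * angularDeriv f.1 z = a z)
    (hbinv : ∀ f ∈ Γ, ∀ z,
      b (f.1 z) * angularDeriv f.1 z + angularDeriv2 f.1 z / angularDeriv f.1 z = b z) :
    ContDiff ℝ 1 fun x => a (Circle.exp x) := by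
  obtain ⟨Φ, k, hk, hd, hΦ⟩ := exists_lift_of_density ha hpos
  obtain ⟨e, he⟩ := exists_homeomorph_eq hΦ (fun x => mul_pos hk (hpos _)) hd
  have hbc : Continuous fun x => b (Circle.exp x) := hb.comp Circle.exp.continuous
  have hac : Continuous fun x => a (Circle.exp x) := ha.comp Circle.exp.continuous
  set β : ℝ → ℝ := fun x => ∫ t in (0 : ℝ)..x, b (Circle.exp t)
  have hβ : ∀ x, HasDerivAt β (b (Circle.exp x)) x := hasDerivAt_integral_of_continuous hbc
  have hβC : ContDiff ℝ 1 β := contDiff_one_of_hasDerivAt hβ hbc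
  have hΦC : ContDiff ℝ 1 Φ := contDiff_one_of_hasDerivAt hd (by fun_prop)
  -- Both `β` and `log a` change under a lift `F` by `-log (deriv F)`, up to a constant; the
  -- difference cancels this term.
  set u : ℝ → ℝ := fun x => β x - Real.log (a (Circle.exp x)) with hu
  have huc : Continuous u := hβC.continuous.sub (hac.log fun x => (hpos _).ne')
  have hucst : ∀ f ∈ Γ, ∀ F, IsC2LiftOf F f.1 → ∃ C, ∀ x, u (F x) - u x = C := by
    intro f hf F hF
    have hderiv : ∀ x, HasDerivAt (fun x => β (F x) + Real.log (deriv F x) - β x) 0 x := fun x => by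
      refine ((((hβ (F x)).comp x (hF.hasDerivAt x)).add
        ((hF.hasDerivAt_deriv x).log (hF.deriv_pos x).ne')).sub (hβ x)).congr_deriv ?_
      rw [← hbinv f hf (Circle.exp x), hF.exp_eq, hF.angularDeriv_exp, hF.angularDeriv2_exp,
        sub_self]
    obtain ⟨C, hC⟩ := exists_eq_const_of_hasDerivAt_zero hderiv
    refine ⟨C, fun x => ?_⟩
    have h1 := hainv f hf (Circle.exp x)
    rw [← hF.exp_eq, hF.angularDeriv_exp] at h1
    have h2 := Real.log_mul (hpos (Circle.exp (F x))).ne' (hF.deriv_pos x).ne'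
    rw [h1] at h2
    simp only [hu]
    linarith [hC x]
  have hdense : Dense (translationGroup Γ (circleMapOfLift Φ) : Set ℝ) := by
    refine dense_translationGroup (circleMapOfLift_injective hΦ ?_) fun f hf => ?_
    · rw [← funext he]
      exact e.injective
    · obtain ⟨F, hF⟩ := f.2.1.exists_lift
      obtain ⟨t, ht⟩ := exists_translation_of_density hd hF (hainv f hf)
      refine ⟨t, fun z => ?_⟩
      obtain ⟨x, rfl⟩ := Circle.exp_surjective z
      rw [← hF.exp_eq, circleMapOfLift_exp hΦ, circleMapOfLift_exp hΦ, ht, Circle.exp_add, mul_comm]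
  obtain ⟨l, hl⟩ := eq_affine_of_dense (v := fun y => u (e.symm y)) (huc.comp e.symm.continuous)
    hdense (by
      rintro t ⟨f, hf, hft⟩
      obtain ⟨F, hF⟩ := f.2.1.exists_lift
      obtain ⟨s, hs⟩ := exists_translation_of_density hd hF (hainv f hf)
      -- Membership of `t` only fixes the rotation `exp t`, so the chosen lift `F` may translate by
      -- another representative `s`. Subtracting `2πm` from `F` gives the lift that translates by
      -- exactly `t`.
      obtain ⟨m, hm⟩ : ∃ m : ℤ, s = t + m * (2 * Real.pi) := by
        rw [← Circle.exp_eq_exp]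
        have := hft (Circle.exp 0)
        rw [← hF.exp_eq, circleMapOfLift_exp hΦ, circleMapOfLift_exp hΦ, hs, Circle.exp_add,
          mul_comm] at this
        exact mul_right_cancel this
      have hF' := hF.sub_int_mul m
      obtain ⟨C, hC⟩ := hucst f hf _ hF'
      have hstep : ∀ y, e.symm (y + t) = F (e.symm y) - m * (2 * Real.pi) := fun y => by
        rw [e.symm_apply_eq, he]
        have h := map_add_int_mul_two_pi hΦ (-m) (F (e.symm y))
        push_cast at h
        rw [sub_eq_add_neg, ← neg_mul, h, hs, ← he, e.apply_symm_apply, hm]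
        ring
      have hconst : ∀ y, u (e.symm (y + t)) - u (e.symm y) = C := fun y => by
        rw [hstep, hC]
      intro y
      have h0 := hconst 0
      rw [zero_add] at h0
      rw [hconst, h0])
  -- Solving `β - log a = u (e.symm 0) + l * Φ` for `a` leaves only `C¹` functions on the right.
  have hfin : (fun x => a (Circle.exp x)) =
      fun x => Real.exp (β x - u (e.symm 0) - l * Φ x) := by
    funext x
    have h := hl (e x)
    rw [e.symm_apply_apply, he] at h
    rw [← Real.exp_log (hpos (Circle.exp x))]
    congr 1
    simp only [hu] at h ⊢
    linarith
  rw [hfin]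
  exact ((hβC.sub contDiff_const).sub (contDiff_const.mul hΦC)).exp

end

/-! ### The equivalence -/

theorem theoremA (Γ : Subgroup CircleDiff2) :
    IsReducible (fun (f : Γ) (z : Circle) => projectiveDerivative (f : CircleDiff2) z)
        rotationSubgroup ↔
      IsC2ConjugateToRotations Γ := by
  refine ⟨fun h => ?_, isReducible_of_isC2ConjugateToRotations⟩
  rcases finite_or_infinite Γ with hfin | hinf
  · exact isC2ConjugateToRotations_of_finite Γ
  · obtain ⟨a, b, ha, hb, hpos, hainv, hbinv⟩ := exists_invariant_of_isReducible h
    exact isC2ConjugateToRotations_of_density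
      (contDiff_density_of_infinite ha hb hpos hainv hbinv) hpos hainv
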